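/- Let $G=(V,E)$ be a finite simple graph and $\omega$ an acyclic orientation of $G$. Let $P(G,\omega)$ be the poset on $V$ in which $i\le j$ iff $\omega$ has a directed path from $i$ to $j$, let $\hat G^{\mathrm{Hasse}}(P(G,\omega))$ be its Hasse diagram (the graph of its cover relations) and $\bar G(P(G,\omega))$ its transitive closure (the graph joining distinct comparable elements). Let $[\omega]$ be the class of $\omega$ under the equivalence relation on acyclic orientations of $G$ generated by converting a source vertex into a sink. For $i\ne j$ in $V$ put $H^{\mathrm{tor}}_{ij}=\{x\in\mathbb{R}^V/\mathbb{Z}^V : x_i=x_j \text{ in } \mathbb{R}/\mathbb{Z}\}$. For a graph $H$ on $V$, a toric chamber for $H$ is a connected component of the complement in $\mathbb{R}^V/\mathbb{Z}^V$ of the union of the $H^{\mathrm{tor}}_{ij}$ over the edges $\{i,j\}$ of $H$. A point $x$ of this complement for $G$ determines the acyclic orientation $\bar\alpha_G(x)$ of $G$ with $i\to j$ iff $(x_i\bmod 1)<(x_j\bmod 1)$, representatives being taken in $[0,1)$. The toric poset $P=P(G,[\omega])$ is given by the toric chamber $c(P)=\{x : \bar\alpha_G(x)\in[\omega]\}$ for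 $G$. The toric Hasse diagram $\hat G^{\mathrm{torHasse}}(P)$ is the smallest graph on $V$ (with respect to inclusion of edge sets) for which $c(P)$ is a toric chamber, i.e. the intersection of all such graphs. The toric transitive closure $\bar G^{\mathrm{tor}}(P)$ is the graph on $V$ whose edges are the pairs $\{i,j\}$, $i\neq j$, with $H^{\mathrm{tor}}_{ij}\cap c(P)=\varnothing$ (in particular all edges of $G$). Then \[ E\big(\hat G^{\mathrm{Hasse}}(P(G,\omega))\big)\subseteq E\big(\hat G^{\mathrm{torHasse}}(P)\big)\subseteq E\big(\bar G^{\mathrm{tor}}(P)\big)=\bigcap_{\omega'\in[\omega]}E\big(\bar G(P(G,\omega'))\big). \] -/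

import Mathlib

namespace ToricPoset

/-! ### Acyclic orientations, their posets, and flips -/

/-- An acyclic orientation `ω ∈ Acyc(G)`: `arrow i j` is `i → j`. Acyclicity excludes 2-cycles,
so every edge is directed in exactly one way. -/
@[ext]
structure AcyclicOrientation {V : Type*} (G : SimpleGraph V) where
  /-- `arrow i j` means that the edge `{i, j}` is directed `i → j`. -/
  arrow : V → V → Prop
  adj_iff : ∀ i j, G.Adj i j ↔ arrow i j ∨ arrow j i
  acyclic : ∀ i, ¬ Relation.TransGen arrow i i

/-- The poset `P(G, ω)` on `V`: `i ≤ j` iff there is a directed path (possibly of length zero)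
from `i` to `j` in `ω`. -/
@[reducible]
def AcyclicOrientation.poset {V : Type*} {G : SimpleGraph V} (ω : AcyclicOrientation G) :
    PartialOrder V where
  le := Relation.ReflTransGen ω.arrow
  le_refl _ := Relation.ReflTransGen.refl
  le_trans _ _ _ := Relation.ReflTransGen.trans
  le_antisymm i j hij hji := by
    rcases Relation.reflTransGen_iff_eq_or_transGen.1 hij with h | h
    · exact h.symm
    · exact absurd (h.trans_left hji) (ω.acyclic i)

/-- The Hasse diagram of a poset: the graph of its covering relation. -/
def hasseDiagram {V : Type*} (P : PartialOrder V) : SimpleGraph V :=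
  @SimpleGraph.hasse V P.toPreorder

/-- The transitive closure of a poset, as a graph: distinct `i`, `j` are joined iff they are
comparable. -/
def transClosure {V : Type*} (P : PartialOrder V) : SimpleGraph V :=
  SimpleGraph.fromRel P.lt

/-- `ω'` arises from `ω` by a flip of a source `v` of `ω` into a sink. -/
def IsFlip {V : Type*} {G : SimpleGraph V} (ω ω' : AcyclicOrientation G) : Prop :=
  ∃ v, (∀ u, ¬ ω.arrow u v) ∧
    ∀ i j, ω'.arrow i j ↔ (i ≠ v ∧ ω.arrow i j) ∨ (j = v ∧ ω.arrow v i)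

/-- The toric equivalence class `[ω]`, for the equivalence relation generated by flips. -/
def toricClass {V : Type*} {G : SimpleGraph V} (ω : AcyclicOrientation G) :
    Set (AcyclicOrientation G) :=
  {ω' | Relation.EqvGen IsFlip ω ω'}

/-! ### Toric arrangements and toric chambers -/

/-- The torus `ℝ^V / ℤ^V`. -/
abbrev Torus (V : Type*) := V → UnitAddCircle

/-- The representative of `t ∈ ℝ/ℤ` in `[0, 1)`. -/
noncomputable def rep (t : UnitAddCircle) : ℝ :=
  (AddCircle.equivIco (1 : ℝ) 0 t : ℝ)

theorem rep_injective : Function.Injective rep :=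
  Subtype.val_injective.comp (AddCircle.equivIco (1 : ℝ) 0).injective

/-- The toric hyperplane `H^tor_{ij}`. -/
def toricHyperplane {V : Type*} (i j : V) : Set (Torus V) :=
  {x | x i = x j}

/-- The toric graphic arrangement of `G`, as a set of points. -/
def toricArrangement {V : Type*} (G : SimpleGraph V) : Set (Torus V) :=
  {x | ∃ i j, G.Adj i j ∧ x ∈ toricHyperplane i j}

/-- `c` is a toric chamber for `G`: a connected component of the complement of the toric graphic
arrangement of `G`. -/
def IsToricChamber {V : Type*} (G : SimpleGraph V) (c : Set (Torus V)) : Prop :=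
  ∃ x ∈ (toricArrangement G)ᶜ, c = connectedComponentIn (toricArrangement G)ᶜ x

/-- The acyclic orientation determined by a point `x` off the toric graphic arrangement of `G`:
the edge `{i, j}` is directed `i → j` iff `x i mod 1 < x j mod 1`. -/
noncomputable def orientationOf {V : Type*} (G : SimpleGraph V) (x : Torus V)
    (hx : x ∈ (toricArrangement G)ᶜ) : AcyclicOrientation G where
  arrow i j := G.Adj i j ∧ rep (x i) < rep (x j)
  adj_iff i j := by
    constructor
    · intro h
      have hne : rep (x i) ≠ rep (x j) := fun e => hx ⟨i, j, h, rep_injective e⟩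
      rcases lt_or_gt_of_ne hne with h' | h'
      · exact Or.inl ⟨h, h'⟩
      · exact Or.inr ⟨h.symm, h'⟩
    · rintro (h | h)
      · exact h.1
      · exact h.1.symm
  acyclic i h := by
    have key : ∀ j, Relation.TransGen (fun a b => G.Adj a b ∧ rep (x a) < rep (x b)) i j →
        rep (x i) < rep (x j) := by
      intro j hj
      induction hj with
      | single h => exact h.2
      | tail _ h ih => exact ih.trans h.2
    exact lt_irrefl _ (key i h)

/-- The toric poset `P(G, [ω])`, i.e. the toric chamber `c(P(G, [ω]))`: the set of all points off
the toric graphic arrangement of `G` whose orientation lies in `[ω]`. -/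
def toricPoset {V : Type*} {G : SimpleGraph V} (ω : AcyclicOrientation G) : Set (Torus V) :=
  {x | ∃ hx : x ∈ (toricArrangement G)ᶜ, orientationOf G x hx ∈ toricClass ω}

/-- The toric Hasse diagram of a toric poset `c`: the smallest of the graphs `H` on `V` such that
`c` is a toric chamber for `H`, given as the intersection of all of them. -/
def toricHasseDiagram {V : Type*} (c : Set (Torus V)) : SimpleGraph V :=
  sInf {H | IsToricChamber H c}

/-- The toric transitive closure of a toric poset `c`: distinct `i`, `j` are joined iff the toric
hyperplane `H^tor_{ij}` does not cut `c`. (If `c` is a chamber for `G`, this holds in particular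
for all edges of `G`.) -/
def toricTransClosure {V : Type*} (c : Set (Torus V)) : SimpleGraph V :=
  SimpleGraph.fromRel fun i j => toricHyperplane i j ∩ c = ∅

end ToricPoset

namespace ToricPoset

open Relation

/-! ### Orientations and their toric classes -/

section Orientation

variable {V : Type*} {G : SimpleGraph V}

/-! The chamber of `[ω]` is the image in the torus of the convex open set `lifts ω`: a flip at `v`
only moves the real coordinate of `v` by one (`toricPoset_eq_image_lifts`). Hence it is open and
connected, and a chamber for `G`; so the toric Hasse diagram lies in `G`, whose hyperplanes miss the
chamber. This is the middle inclusion.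

For the equality, a point of the chamber on `H^tor_{ij}` has an orientation in `[ω]` leaving `i`,
`j` incomparable; conversely, incomparable elements can share a rank, which gives such a point.

For the first inclusion, let `j` cover `i` and let `H` be a graph without the edge `{i, j}`. A path
in the torus starting in the chamber can merge `i` with `j` and keep all other coordinates apart. It
avoids the arrangement of `H`, yet ends on a hyperplane of `G`, so the chamber is not one for `H`
(`adj_of_isToricChamber_of_covers`). -/

theorem AcyclicOrientation.adj (ω : AcyclicOrientation G) {i j : V} (h : ω.arrow i j) :
    G.Adj i j :=
  (ω.adj_iff i j).2 (Or.inl h)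

theorem AcyclicOrientation.arrow_iff_of_strict (ω : AcyclicOrientation G) {f : V → ℝ}
    (hf : ∀ i j, ω.arrow i j → f i < f j) (i j : V) :
    ω.arrow i j ↔ G.Adj i j ∧ f i < f j := by
  refine ⟨fun h => ⟨ω.adj h, hf i j h⟩, fun ⟨h, hlt⟩ => ?_⟩
  rcases (ω.adj_iff i j).1 h with h | h
  · exact h
  · exact absurd (hf j i h) hlt.not_gt

/-- The acyclic orientation along which a function injective on edges increases. -/
def AcyclicOrientation.ofFun (G : SimpleGraph V) (f : V → ℝ)
    (hf : ∀ i j, G.Adj i j → f i ≠ f j) : AcyclicOrientation G where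
  arrow i j := G.Adj i j ∧ f i < f j
  adj_iff i j := by
    constructor
    · intro h
      rcases lt_or_gt_of_ne (hf i j h) with h' | h'
      · exact Or.inl ⟨h, h'⟩
      · exact Or.inr ⟨h.symm, h'⟩
    · rintro (h | h)
      · exact h.1
      · exact h.1.symm
  acyclic i h := by
    have key : ∀ j, TransGen (fun a b => G.Adj a b ∧ f a < f b) i j → f i < f j := by
      intro j hj
      induction hj with
      | single h => exact h.2
      | tail _ h ih => exact ih.trans h.2
    exact lt_irrefl _ (key i h)

theorem lt_poset_iff (ω : AcyclicOrientation G) (i j : V) :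
    ω.poset.lt i j ↔ TransGen ω.arrow i j := by
  constructor
  · rintro ⟨h, h'⟩
    rcases reflTransGen_iff_eq_or_transGen.1 h with rfl | h
    · exact absurd ReflTransGen.refl h'
    · exact h
  · intro h
    exact ⟨h.to_reflTransGen, fun h' => ω.acyclic i (h.trans_left h')⟩

theorem mem_toricClass_self (ω : AcyclicOrientation G) : ω ∈ toricClass ω :=
  EqvGen.refl ω

theorem toricClass_eq_of_mem {ω ω' : AcyclicOrientation G} (h : ω' ∈ toricClass ω) :
    toricClass ω' = toricClass ω :=
  Set.ext fun _ => ⟨fun h' => EqvGen.trans _ _ _ h h',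
    fun h' => EqvGen.trans _ _ _ (EqvGen.symm _ _ h) h'⟩

theorem toricPoset_eq_of_mem {ω ω' : AcyclicOrientation G} (h : ω' ∈ toricClass ω) :
    toricPoset ω' = toricPoset ω := by
  simp only [toricPoset, toricClass_eq_of_mem h]

theorem toricPoset_subset (ω : AcyclicOrientation G) :
    toricPoset ω ⊆ (toricArrangement G)ᶜ :=
  fun _ hx => hx.1

end Orientation

/-! ### The chamber as the image of a convex set -/

section Lifts

variable {V : Type*} {G : SimpleGraph V}

/-- The projection `ℝ^V → ℝ^V / ℤ^V`. -/
def proj (f : V → ℝ) : Torus V := Pi.map (fun _ (t : ℝ) => (t : UnitAddCircle)) f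

theorem continuous_proj : Continuous (proj : (V → ℝ) → Torus V) :=
  Continuous.piMap fun _ => AddCircle.continuous_mk' 1

theorem isOpenMap_proj : IsOpenMap (proj : (V → ℝ) → Torus V) :=
  IsOpenMap.piMap (fun _ => QuotientAddGroup.isOpenMap_coe)
    (Filter.Eventually.of_forall fun _ => QuotientAddGroup.mk_surjective)

theorem rep_coe {t : ℝ} (h0 : 0 ≤ t) (h1 : t < 1) : rep (t : UnitAddCircle) = t :=
  AddCircle.equivIco_coe_of_mem (a := (0 : ℝ)) (p := 1) ⟨h0, by simpa using h1⟩

theorem coe_rep (t : UnitAddCircle) : ((rep t : ℝ) : UnitAddCircle) = t :=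
  AddCircle.coe_equivIco

theorem rep_nonneg (t : UnitAddCircle) : 0 ≤ rep t :=
  (AddCircle.equivIco (1 : ℝ) 0 t).2.1

theorem rep_lt_one (t : UnitAddCircle) : rep t < 1 :=
  (AddCircle.equivIco (1 : ℝ) 0 t).2.2.trans_eq (zero_add 1)

theorem proj_eq_of_sub_int {f g : V → ℝ} (h : ∀ v, ∃ n : ℤ, f v = g v + n) :
    proj f = proj g := by
  funext v
  obtain ⟨n, hn⟩ := h v
  simp only [proj, Pi.map_apply, hn]
  have : ((n : ℝ) : UnitAddCircle) = 0 :=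
    (QuotientAddGroup.eq_zero_iff _).2 (AddSubgroup.mem_zmultiples_iff.2 ⟨n, by simp⟩)
  rw [AddCircle.coe_add, this, add_zero]

theorem proj_mem_compl_of_strict (ω : AcyclicOrientation G) {f : V → ℝ} (h0 : ∀ v, 0 ≤ f v)
    (h1 : ∀ v, f v < 1) (hf : ∀ i j, ω.arrow i j → f i < f j) :
    ∃ hx : proj f ∈ (toricArrangement G)ᶜ, orientationOf G (proj f) hx = ω := by
  have hrep : ∀ v, rep (proj f v) = f v := fun v => rep_coe (h0 v) (h1 v)
  have hx : proj f ∈ (toricArrangement G)ᶜ := by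
    rintro ⟨i, j, hij, e⟩
    have e' : f i = f j := by rw [← hrep i, ← hrep j, show proj f i = proj f j from e]
    rcases (ω.adj_iff i j).1 hij with h | h
    · exact (hf _ _ h).ne e'
    · exact (hf _ _ h).ne' e'
  refine ⟨hx, ?_⟩
  ext i j
  simp only [orientationOf, hrep]
  exact (ω.arrow_iff_of_strict hf i j).symm

theorem proj_mem_toricPoset_of_strict (ω : AcyclicOrientation G) {f : V → ℝ}
    (h0 : ∀ v, 0 ≤ f v) (h1 : ∀ v, f v < 1) (hf : ∀ i j, ω.arrow i j → f i < f j) :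
    proj f ∈ toricPoset ω := by
  obtain ⟨hx, h⟩ := proj_mem_compl_of_strict ω h0 h1 hf
  exact ⟨hx, h ▸ mem_toricClass_self ω⟩

/-- The points of `ℝ^V` at which every edge increases along `ω`, by less than one. -/
def lifts (ω : AcyclicOrientation G) : Set (V → ℝ) :=
  {f | ∀ i j, ω.arrow i j → f i < f j ∧ f j < f i + 1}

theorem convex_lifts (ω : AcyclicOrientation G) : Convex ℝ (lifts ω) := by
  intro f hf g hg a b ha hb hab i j hij
  obtain ⟨h1, h2⟩ := hf i j hij
  obtain ⟨h3, h4⟩ := hg i j hij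
  simp only [Pi.add_apply, Pi.smul_apply, smul_eq_mul]
  rcases ha.eq_or_lt with rfl | ha
  · obtain rfl : b = 1 := by linarith
    constructor <;> linarith
  · constructor
    · linarith [mul_lt_mul_of_pos_left h1 ha, mul_le_mul_of_nonneg_left h3.le hb]
    · linarith [mul_lt_mul_of_pos_left h2 ha, mul_le_mul_of_nonneg_left h4.le hb]

theorem isOpen_lifts [Finite V] (ω : AcyclicOrientation G) : IsOpen (lifts ω) := by
  have : lifts ω = ⋂ i, ⋂ j, {f : V → ℝ | ω.arrow i j → f i < f j ∧ f j < f i + 1} := by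
    ext f
    simp [lifts]
  rw [this]
  refine isOpen_iInter_of_finite fun i => isOpen_iInter_of_finite fun j => ?_
  by_cases h : ω.arrow i j
  · simp only [h, true_imp_iff]
    have hi := continuous_apply (A := fun _ : V => ℝ) i
    have hj := continuous_apply (A := fun _ : V => ℝ) j
    exact (isOpen_lt hi hj).inter (isOpen_lt hj (hi.add continuous_const))
  · simp [h]

/-- Adding one at the source `v` fixes the point of the torus and turns `f v < f u < f v + 1` into
`f u < f v + 1 < f u + 1`, the condition for the reversed edge. -/
theorem image_lifts_subset_of_isFlip {ω ω' : AcyclicOrientation G} (h : IsFlip ω ω') :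
    proj '' lifts ω ⊆ proj '' lifts ω' := by
  classical
  obtain ⟨v, hv, harr⟩ := h
  rintro _ ⟨f, hf, rfl⟩
  refine ⟨fun a => f a + ((if a = v then 1 else 0 : ℤ) : ℝ), ?_,
    proj_eq_of_sub_int fun a => ⟨_, rfl⟩⟩
  intro i j hij
  rcases (harr i j).1 hij with ⟨hi, hij⟩ | ⟨rfl, hji⟩
  · have hj : j ≠ v := fun e => hv i (e ▸ hij)
    simpa [hi, hj] using hf i j hij
  · have hi : i ≠ j := (ω.adj hji).ne'
    have := hf _ _ hji
    simp only [hi, if_false, if_true, Int.cast_zero, Int.cast_one]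
    constructor <;> linarith

theorem image_lifts_subset_of_isFlip' {ω ω' : AcyclicOrientation G} (h : IsFlip ω ω') :
    proj '' lifts ω' ⊆ proj '' lifts ω := by
  classical
  obtain ⟨v, hv, harr⟩ := h
  rintro _ ⟨f, hf, rfl⟩
  refine ⟨fun a => f a + ((if a = v then -1 else 0 : ℤ) : ℝ), ?_,
    proj_eq_of_sub_int fun a => ⟨_, rfl⟩⟩
  intro i j hij
  have hj : j ≠ v := fun e => hv i (e ▸ hij)
  by_cases hi : i = v
  · subst hi
    have := hf j i ((harr j i).2 (Or.inr ⟨rfl, hij⟩))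
    simp only [hj, if_false, if_true, Int.cast_zero, Int.cast_one, Int.cast_neg]
    constructor <;> linarith
  · simpa [hi, hj] using hf i j ((harr i j).2 (Or.inl ⟨hi, hij⟩))

theorem image_lifts_eq_of_mem {ω ω' : AcyclicOrientation G} (h : ω' ∈ toricClass ω) :
    proj '' lifts ω = proj '' lifts ω' := by
  induction h with
  | rel _ _ h => exact (image_lifts_subset_of_isFlip h).antisymm (image_lifts_subset_of_isFlip' h)
  | refl => rfl
  | symm _ _ _ ih => exact ih.symm
  | trans _ _ _ _ _ ih ih' => exact ih.trans ih'

theorem toricPoset_subset_image_lifts (ω : AcyclicOrientation G) :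
    toricPoset ω ⊆ proj '' lifts ω := by
  rintro x ⟨hx, h⟩
  rw [image_lifts_eq_of_mem h]
  refine ⟨fun v => rep (x v), fun i j hij => ⟨hij.2, ?_⟩, funext fun v => coe_rep (x v)⟩
  linarith [rep_nonneg (x i), rep_lt_one (x j)]

/-- Induction on the total integer part: at zero all coordinates are representatives in `[0, 1)`;
otherwise lowering a largest coordinate by one undoes a flip. -/
theorem proj_mem_toricPoset_of_nonneg [Fintype V] (n : ℕ) :
    ∀ (ω : AcyclicOrientation G) (f : V → ℝ), (∀ v, 0 ≤ f v) → f ∈ lifts ω →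
      ∑ v, ⌊f v⌋ = n → proj f ∈ toricPoset ω := by
  classical
  induction n with
  | zero =>
    intro ω f h0 hf hn
    have hfl : ∀ v, ⌊f v⌋ = 0 := fun v =>
      (Finset.sum_eq_zero_iff_of_nonneg fun v _ => Int.floor_nonneg.2 (h0 v)).1
        (by simpa using hn) v (Finset.mem_univ v)
    exact proj_mem_toricPoset_of_strict ω h0
      (fun v => (Int.floor_eq_zero_iff.1 (hfl v)).2) fun i j h => (hf i j h).1
  | succ n ih =>
    intro ω f h0 hf hn
    obtain ⟨w, hw⟩ : ∃ w, 1 ≤ f w := by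
      by_contra! hlt
      have : ∑ v, ⌊f v⌋ = 0 :=
        Finset.sum_eq_zero fun v _ => Int.floor_eq_zero_iff.2 ⟨h0 v, hlt v⟩
      omega
    obtain ⟨v, -, hv⟩ := Finset.exists_max_image Finset.univ f ⟨w, Finset.mem_univ w⟩
    have hv1 : 1 ≤ f v := hw.trans (hv w (Finset.mem_univ w))
    have harr := ω.arrow_iff_of_strict fun i j h => (hf i j h).1
    have hadj : ∀ i j, G.Adj i j → f i ≠ f j ∧ f j < f i + 1 := by
      intro i j h
      rcases (ω.adj_iff i j).1 h with h | h
      · exact ⟨(hf _ _ h).1.ne, (hf _ _ h).2⟩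
      · exact ⟨(hf _ _ h).1.ne', by linarith [(hf _ _ h).1]⟩
    have hmax : ∀ u, G.Adj u v → f u < f v := fun u h =>
      lt_of_le_of_ne (hv u (Finset.mem_univ u)) (hadj _ _ h).1
    -- By maximality `v` is a sink of `ω`. Each neighbour `u` has `f v < f u + 1`, so after the
    -- shift `v` lies below all its neighbours and is a source.
    set g : V → ℝ := fun a => f a + ((if a = v then -1 else 0 : ℤ) : ℝ) with hg
    have hgv : g v = f v - 1 := by simp [hg, sub_eq_add_neg]
    have hgn : ∀ a, a ≠ v → g a = f a := fun a ha => by simp [hg, ha]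
    have hgadj : ∀ u, G.Adj u v → g v < g u ∧ g u < g v + 1 := fun u h => by
      rw [hgv, hgn u h.ne]
      constructor <;> linarith [hmax u h, (hadj u v h).2]
    have hgne : ∀ i j, G.Adj i j → g i ≠ g j := by
      intro i j h
      by_cases hi : i = v
      · subst hi; exact (hgadj j h.symm).1.ne
      by_cases hj : j = v
      · subst hj; exact (hgadj i h).1.ne'
      rw [hgn i hi, hgn j hj]
      exact (hadj i j h).1
    have hglift : g ∈ lifts (AcyclicOrientation.ofFun G g hgne) := by
      rintro i j ⟨h, hlt⟩
      refine ⟨hlt, ?_⟩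
      by_cases hi : i = v
      · subst hi; exact (hgadj j h.symm).2
      by_cases hj : j = v
      · subst hj; exact absurd hlt (hgadj i h).1.not_gt
      rw [hgn i hi, hgn j hj]
      exact (hadj i j h).2
    have hflip : IsFlip (AcyclicOrientation.ofFun G g hgne) ω := by
      refine ⟨v, fun u h => h.2.not_gt (hgadj u h.1).1, fun i j => ?_⟩
      rw [harr]
      simp only [AcyclicOrientation.ofFun]
      by_cases hi : i = v
      · subst hi
        simp only [ne_eq, not_true_eq_false, false_and, false_or]
        exact ⟨fun h => absurd (hmax j h.1.symm) h.2.not_gt,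
          fun h => absurd h.2.1 (G.irrefl)⟩
      by_cases hj : j = v
      · subst hj
        refine ⟨fun h => Or.inr ⟨rfl, h.1.symm, (hgadj i h.1).1⟩, ?_⟩
        rintro (⟨-, h, -⟩ | ⟨-, h, -⟩)
        · exact ⟨h, hmax i h⟩
        · exact ⟨h.symm, hmax i h.symm⟩
      · simp [hi, hj, hgn i hi, hgn j hj]
    have hproj : proj g = proj f := proj_eq_of_sub_int fun a => ⟨_, rfl⟩
    rw [toricPoset_eq_of_mem (EqvGen.rel _ _ hflip), ← hproj] at *
    refine ih _ g (fun a => ?_) hglift ?_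
    · by_cases ha : a = v
      · subst ha; rw [hgv]; linarith
      · rw [hgn a ha]; exact h0 a
    · simp only [hg, Int.floor_add_intCast, Finset.sum_add_distrib, hn]
      simp

theorem toricPoset_eq_image_lifts [Finite V] (ω : AcyclicOrientation G) :
    toricPoset ω = proj '' lifts ω := by
  refine (toricPoset_subset_image_lifts ω).antisymm ?_
  rintro _ ⟨f, hf, rfl⟩
  have := Fintype.ofFinite V
  -- A common integer translation makes all coordinates nonnegative without moving the point of the
  -- torus.
  obtain ⟨m, hm⟩ := (Set.finite_range f).bddBelow
  have hm' : ∀ v, (⌊m⌋ : ℝ) ≤ f v := fun v => (Int.floor_le m).trans (hm ⟨v, rfl⟩)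
  have h0 : ∀ v, 0 ≤ f v - ⌊m⌋ := fun v => sub_nonneg.2 (hm' v)
  have hproj : proj (fun v => f v - ⌊m⌋) = proj f :=
    proj_eq_of_sub_int fun v => ⟨-⌊m⌋, by push_cast; ring⟩
  rw [← hproj]
  refine proj_mem_toricPoset_of_nonneg (∑ v, ⌊f v - ⌊m⌋⌋).toNat ω _ h0
    (fun i j h => ?_) ?_
  · have := hf i j h
    constructor <;> linarith
  · exact (Int.toNat_of_nonneg (Finset.sum_nonneg fun v _ => Int.floor_nonneg.2 (h0 v))).symm

theorem isPreconnected_toricPoset [Finite V] (ω : AcyclicOrientation G) :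
    IsPreconnected (toricPoset ω) := by
  rw [toricPoset_eq_image_lifts]
  exact (convex_lifts ω).isPreconnected.image _ continuous_proj.continuousOn

theorem isOpen_toricPoset [Finite V] (ω : AcyclicOrientation G) : IsOpen (toricPoset ω) := by
  rw [toricPoset_eq_image_lifts]
  exact isOpenMap_proj _ (isOpen_lifts ω)

theorem isToricChamber_of_mem_toricPoset [Finite V] {ω : AcyclicOrientation G} {x : Torus V}
    (hx : x ∈ toricPoset ω) : IsToricChamber G (toricPoset ω) := by
  refine ⟨x, toricPoset_subset ω hx, Set.Subset.antisymm ?_ ?_⟩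
  · exact (isPreconnected_toricPoset ω).subset_connectedComponentIn hx (toricPoset_subset ω)
  -- The sets of the other classes are open too and, with this one, cover the complement of the
  -- arrangement, so a connected set meeting this one cannot leave it.
  · refine IsPreconnected.subset_left_of_subset_union (isOpen_toricPoset ω)
      (v := ⋃ ω' ∈ (toricClass ω)ᶜ, toricPoset ω')
      (isOpen_biUnion fun ω' _ => isOpen_toricPoset ω') ?_ ?_
      ⟨x, mem_connectedComponentIn (toricPoset_subset ω hx), hx⟩
      isPreconnected_connectedComponentIn
    · rw [Set.disjoint_iUnion₂_right]
      intro ω' hω'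
      rw [Set.disjoint_left]
      rintro y ⟨hy, h⟩ ⟨_, h'⟩
      exact hω' (EqvGen.trans _ _ _ h (EqvGen.symm _ _ h'))
    · intro y hy
      have hyc := connectedComponentIn_subset _ _ hy
      by_cases h : orientationOf G y hyc ∈ toricClass ω
      · exact Or.inl ⟨hyc, h⟩
      · exact Or.inr (Set.mem_iUnion₂.2 ⟨_, h, hyc, mem_toricClass_self _⟩)

end Lifts

/-! ### Rankings compatible with an orientation -/

section Ranking

variable {V : Type*} {G : SimpleGraph V}

theorem AcyclicOrientation.exists_strict [Finite V] (ω : AcyclicOrientation G) :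
    ∃ g : V → ℕ, ∀ a b, TransGen ω.arrow a b → g a < g b := by
  -- Rank by the number of strict predecessors.
  refine ⟨fun a => {c | TransGen ω.arrow c a}.ncard, fun a b hab => ?_⟩
  refine Set.ncard_lt_ncard ⟨fun c hc => TransGen.trans hc hab, fun h => ?_⟩ (Set.toFinite _)
  exact ω.acyclic a (h hab)

/-- Two elements without anything strictly between them can be merged in a ranking. -/
theorem AcyclicOrientation.exists_strict_merging (ω : AcyclicOrientation G) {i j : V}
    (hij : i ≠ j) (hb : ∀ a, TransGen ω.arrow i a → ¬ TransGen ω.arrow a j) {g : V → ℕ}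
    (hg : ∀ a b, TransGen ω.arrow a b → g a < g b) (hle : g i ≤ g j) :
    ∃ y : V → ℕ, y i = y j ∧
      ∀ a b, TransGen ω.arrow a b → y a < y b ∨ (a = i ∧ b = j) := by
  classical
  -- Raise `i` to the level of `j`, carrying along everything above `i` except `j`. Order could only
  -- break at a raised element below `j`, and by `hb` that is `i` alone.
  refine ⟨fun a => if ReflTransGen ω.arrow i a ∧ a ≠ j then g a + (g j - g i) else g a, ?_, ?_⟩
  · simp only [ReflTransGen.refl, hij, ne_eq, not_false_eq_true, and_self, if_true, not_true,
      and_false, if_false]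
    omega
  · intro a b hab
    have hlt := hg a b hab
    by_cases ha : ReflTransGen ω.arrow i a ∧ a ≠ j
    · by_cases hbj : b = j
      · subst hbj
        rcases reflTransGen_iff_eq_or_transGen.1 ha.1 with h | h
        · exact Or.inr ⟨h, rfl⟩
        · exact absurd hab (hb a h)
      · have hib : ReflTransGen ω.arrow i b := ha.1.trans hab.to_reflTransGen
        left
        simp only [if_pos ha, if_pos (And.intro hib hbj)]
        omega
    · left
      simp only [if_neg ha]
      split_ifs <;> omega

/-- The merged ranking can be taken injective outside of the merged pair. -/
theorem AcyclicOrientation.exists_strict_merging_injOn [Finite V] (ω : AcyclicOrientation G)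
    {i j : V} (hij : TransGen ω.arrow i j)
    (hb : ∀ a, TransGen ω.arrow i a → ¬ TransGen ω.arrow a j) :
    ∃ y : V → ℕ, y i = y j ∧
      (∀ a b, TransGen ω.arrow a b → y a < y b ∨ (a = i ∧ b = j)) ∧
      ∀ a b, y a = y b → a = b ∨ (a = i ∧ b = j) ∨ (a = j ∧ b = i) := by
  classical
  have hne : i ≠ j := fun e => ω.acyclic i (by rw [← e] at hij; exact hij)
  obtain ⟨g, hg⟩ := ω.exists_strict
  obtain ⟨y, hy, hys⟩ := ω.exists_strict_merging hne hb hg (hg i j hij).le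
  have := Fintype.ofFinite V
  set N := Fintype.card V
  -- A tie-breaker in `[0, N)` separating all vertices except `i` from `j`; `N * y + e` then orders
  -- lexicographically.
  let e : V → ℕ := fun a => Fintype.equivFin V (if a = i then j else a)
  have he : ∀ a, e a < N := fun a => Fin.is_lt _
  refine ⟨fun a => N * y a + e a, by simp [e, hy], fun a b hab => ?_, fun a b hab => ?_⟩
  · refine (hys a b hab).imp_left fun h => ?_
    have h1 : N * (y a + 1) ≤ N * y b := Nat.mul_le_mul_left N h
    have h2 := he a
    rw [Nat.mul_add] at h1
    simp only
    omega
  · have hmod : e a = e b := by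
      have := congrArg (· % N) hab
      simpa [Nat.mul_add_mod, Nat.mod_eq_of_lt (he _)] using this
    have : (if a = i then j else a) = if b = i then j else b :=
      (Fintype.equivFin V).injective (Fin.ext hmod)
    split_ifs at this <;> grind

/-- Incomparable elements can be given the same rank. -/
theorem AcyclicOrientation.exists_strict_eq [Finite V] (ω : AcyclicOrientation G)
    {i j : V} (hne : i ≠ j) (hij : ¬ TransGen ω.arrow i j) (hji : ¬ TransGen ω.arrow j i) :
    ∃ y : V → ℕ, y i = y j ∧ ∀ a b, TransGen ω.arrow a b → y a < y b := by
  obtain ⟨g, hg⟩ := ω.exists_strict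
  wlog hle : g i ≤ g j generalizing i j
  · obtain ⟨y, hy, h⟩ := this hne.symm hji hij (le_of_not_ge hle)
    exact ⟨y, hy.symm, h⟩
  -- Nothing lies between incomparable elements.
  obtain ⟨y, hy, h⟩ := ω.exists_strict_merging hne (fun a h h' => hij (h.trans h')) hg hle
  refine ⟨y, hy, fun a b hab => (h a b hab).resolve_right ?_⟩
  rintro ⟨rfl, rfl⟩
  exact hij hab

/-- The slack of two keeps `(y v + 1) / M` below one, so that ranks, even shifted up by one, rescale
into `[0, 1)`. -/
theorem exists_nat_bound [Finite V] (y : V → ℕ) : ∃ M : ℕ, ∀ v, y v + 2 ≤ M := by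
  obtain ⟨m, hm⟩ := (Set.finite_range y).bddAbove
  exact ⟨m + 2, fun v => Nat.add_le_add_right (hm ⟨v, rfl⟩) 2⟩

theorem exists_mem_toricPoset_eq [Finite V] (ω : AcyclicOrientation G) {y : V → ℕ}
    (hy : ∀ a b, TransGen ω.arrow a b → y a < y b) :
    ∃ x ∈ toricPoset ω, ∀ a b, y a = y b → x a = x b := by
  obtain ⟨M, hM⟩ := exists_nat_bound y
  refine ⟨proj fun v => (y v : ℝ) / M, proj_mem_toricPoset_of_strict ω (fun v => by positivity)
    (fun v => ?_) (fun a b h => ?_), fun a b h => by simp [proj, h]⟩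
  · have := hM v
    rw [div_lt_one (by norm_cast; omega)]
    norm_cast
    omega
  · have := hM a
    have := hy a b (TransGen.single h)
    have hM0 : (0 : ℝ) < M := by norm_cast; omega
    gcongr

theorem isToricChamber_toricPoset [Finite V] (ω : AcyclicOrientation G) :
    IsToricChamber G (toricPoset ω) := by
  obtain ⟨g, hg⟩ := ω.exists_strict
  obtain ⟨x, hx, -⟩ := exists_mem_toricPoset_eq ω hg
  exact isToricChamber_of_mem_toricPoset hx

end Ranking

/-! ### Comparison of the three graphs -/

section Graphs

variable {V : Type*} {G : SimpleGraph V}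

theorem rep_lt_of_transGen {x : Torus V} {hx : x ∈ (toricArrangement G)ᶜ} {i j : V}
    (h : TransGen (orientationOf G x hx).arrow i j) : rep (x i) < rep (x j) := by
  induction h with
  | single h => exact h.2
  | tail _ h ih => exact ih.trans h.2

theorem toricTransClosure_adj_iff [Finite V] (ω : AcyclicOrientation G) (i j : V) :
    (toricTransClosure (toricPoset ω)).Adj i j ↔
      ∀ ω' ∈ toricClass ω, (transClosure ω'.poset).Adj i j := by
  simp only [toricTransClosure, transClosure, SimpleGraph.fromRel_adj, lt_poset_iff]
  have hsymm : toricHyperplane j i ∩ toricPoset ω = toricHyperplane i j ∩ toricPoset ω := by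
    ext x
    simp [toricHyperplane, eq_comm]
  rw [hsymm, or_self]
  constructor
  · rintro ⟨hne, hempty⟩ ω' hω'
    refine ⟨hne, ?_⟩
    by_contra! hinc
    obtain ⟨y, hy, hys⟩ := ω'.exists_strict_eq hne hinc.1 hinc.2
    obtain ⟨x, hx, hxy⟩ := exists_mem_toricPoset_eq ω' hys
    rw [toricPoset_eq_of_mem hω'] at hx
    exact Set.eq_empty_iff_forall_notMem.1 hempty x ⟨hxy i j hy, hx⟩
  · intro h
    refine ⟨(h ω (mem_toricClass_self ω)).1, Set.eq_empty_of_forall_notMem ?_⟩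
    rintro x ⟨hxij, hx, hmem⟩
    have e : rep (x i) = rep (x j) := congrArg rep hxij
    rcases (h _ hmem).2 with h | h
    · exact (rep_lt_of_transGen h).ne e
    · exact (rep_lt_of_transGen h).ne' e

theorem toricHasseDiagram_le_toricTransClosure [Finite V] (ω : AcyclicOrientation G) :
    toricHasseDiagram (toricPoset ω) ≤ toricTransClosure (toricPoset ω) := by
  intro i j h
  have hG : G.Adj i j := (SimpleGraph.sInf_adj.1 h).1 G (isToricChamber_toricPoset ω)
  refine (SimpleGraph.fromRel_adj _ _ _).2 ⟨hG.ne, Or.inl ?_⟩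
  refine Set.eq_empty_of_forall_notMem fun x ⟨hx, hxc⟩ => ?_
  exact toricPoset_subset ω hxc ⟨i, j, hG, hx⟩

/-- If `{i, j}` were not an edge of `H`, one could slide from the chamber onto `H^tor_{ij}` without
meeting the arrangement of `H`. -/
theorem adj_of_isToricChamber_of_covers [Finite V] (ω : AcyclicOrientation G) {i j : V}
    (hij : TransGen ω.arrow i j)
    (hb : ∀ a, TransGen ω.arrow i a → ¬ TransGen ω.arrow a j) {H : SimpleGraph V}
    (hH : IsToricChamber H (toricPoset ω)) : H.Adj i j := by
  classical
  by_contra hnot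
  -- A path from `i` to `j` with an intermediate vertex would contradict the covering hypothesis.
  have harr : ω.arrow i j := by
    obtain ⟨k, hik, hkj⟩ := TransGen.head'_iff.1 hij
    rcases reflTransGen_iff_eq_or_transGen.1 hkj with h | h
    · rwa [h]
    · exact absurd h (hb k (TransGen.single hik))
  obtain ⟨y, hyij, hys, hyinj⟩ := ω.exists_strict_merging_injOn hij hb
  obtain ⟨M, hM⟩ := exists_nat_bound y
  have hM0 : (0 : ℝ) < M := by
    have := hM i
    norm_cast
    omega
  -- Lower `i` by `t ≤ 1 / 2`, less than the gap between distinct ranks, so only the tie of `i` with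
  -- `j` changes. The `+ 1` keeps the values nonnegative.
  let f : ℝ → V → ℝ := fun t v => (y v + 1 - (if v = i then t else 0)) / M
  have hfcont : Continuous fun t => proj (f t) := by
    refine continuous_proj.comp (continuous_pi fun v => ?_)
    simp only [f]
    split_ifs <;> fun_prop
  have hshift : ∀ t ∈ Set.Icc (0 : ℝ) (1 / 2), ∀ v : V,
      0 ≤ (if v = i then t else 0) ∧ (if v = i then t else 0) ≤ 1 / 2 := by
    rintro t ⟨h0, h1⟩ v
    split_ifs
    · exact ⟨h0, h1⟩
    · norm_num
  have hf0 : ∀ t ∈ Set.Icc (0 : ℝ) (1 / 2), ∀ v, 0 ≤ f t v := by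
    intro t ht v
    have := hshift t ht v
    have : (0 : ℝ) ≤ y v := Nat.cast_nonneg _
    exact div_nonneg (by linarith) hM0.le
  have hf1 : ∀ t ∈ Set.Icc (0 : ℝ) (1 / 2), ∀ v, f t v < 1 := by
    intro t ht v
    have := hshift t ht v
    have : (y v + 2 : ℝ) ≤ M := by exact_mod_cast hM v
    simp only [f]
    rw [div_lt_one hM0]
    linarith
  have hflt : ∀ t ∈ Set.Icc (0 : ℝ) (1 / 2), ∀ a b, y a < y b → f t a < f t b := by
    intro t ht a b hab
    have h1 := hshift t ht a
    have h2 := hshift t ht b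
    have : (y a + 1 : ℝ) ≤ y b := by exact_mod_cast hab
    rcases ht with ⟨ht0, ht1⟩
    refine div_lt_div_of_pos_right ?_ hM0
    linarith
  have hmemH : ∀ t ∈ Set.Icc (0 : ℝ) (1 / 2), proj (f t) ∈ (toricArrangement H)ᶜ := by
    rintro t ht ⟨a, b, hab, e⟩
    have e' : f t a = f t b := by
      rw [← rep_coe (hf0 t ht a) (hf1 t ht a), ← rep_coe (hf0 t ht b) (hf1 t ht b)]
      exact congrArg rep e
    have hy : y a = y b := by
      rcases lt_trichotomy (y a) (y b) with h | h | h
      · exact absurd e' (hflt t ht a b h).ne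
      · exact h
      · exact absurd e' (hflt t ht b a h).ne'
    rcases hyinj a b hy with rfl | ⟨rfl, rfl⟩ | ⟨rfl, rfl⟩
    · exact H.irrefl hab
    · exact hnot hab
    · exact hnot hab.symm
  have hzero : (0 : ℝ) ∈ Set.Icc (0 : ℝ) (1 / 2) := by norm_num
  have hhalf : (1 / 2 : ℝ) ∈ Set.Icc (0 : ℝ) (1 / 2) := by norm_num
  have hend : proj (f (1 / 2)) ∈ toricPoset ω := by
    refine proj_mem_toricPoset_of_strict ω (hf0 _ hhalf) (hf1 _ hhalf) fun a b hab => ?_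
    rcases hys a b (TransGen.single hab) with h | ⟨rfl, rfl⟩
    · exact hflt _ hhalf a b h
    · have hne : b ≠ a := (ω.adj hab).ne'
      refine div_lt_div_of_pos_right ?_ hM0
      rw [if_pos rfl, if_neg hne, hyij]
      norm_num
  -- The path from `t = 1 / 2` to `t = 0` is connected and off the arrangement of `H`, hence stays
  -- in the component.
  have hstart : proj (f 0) ∈ toricPoset ω := by
    obtain ⟨x, -, hx⟩ := hH
    rw [hx] at hend ⊢
    rw [connectedComponentIn_eq hend]
    refine (isPreconnected_Icc.image (fun t => proj (f t))
      hfcont.continuousOn).subset_connectedComponentIn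
      (Set.mem_image_of_mem _ hhalf) ?_ (Set.mem_image_of_mem _ hzero)
    rintro _ ⟨t, ht, rfl⟩
    exact hmemH t ht
  -- At `t = 0` the coordinates of `i` and `j` agree, although `{i, j}` is an edge of `G`.
  refine toricPoset_subset ω hstart ⟨i, j, ω.adj harr, ?_⟩
  simp [toricHyperplane, proj, f, hyij]

theorem hasseDiagram_le_toricHasseDiagram [Finite V] (ω : AcyclicOrientation G) :
    hasseDiagram ω.poset ≤ toricHasseDiagram (toricPoset ω) := by
  intro i j h
  refine SimpleGraph.sInf_adj.2 ⟨fun H hH => ?_, h.ne⟩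
  have key : ∀ a b, (ω.poset.lt a b ∧ ∀ c, ω.poset.lt a c → ¬ ω.poset.lt c b) →
      H.Adj a b := by
    intro a b hab
    simp only [lt_poset_iff] at hab
    exact adj_of_isToricChamber_of_covers ω hab.1 hab.2 hH
  rcases h with h | h
  · exact key i j ⟨h.1, fun c => @h.2 c⟩
  · exact (key j i ⟨h.1, fun c => @h.2 c⟩).symm

end Graphs

end ToricPoset

theorem proposition5p10 {V : Type*} [Finite V] (G : SimpleGraph V)
    (ω : ToricPoset.AcyclicOrientation G) :
    (ToricPoset.hasseDiagram ω.poset).edgeSet ⊆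
        (ToricPoset.toricHasseDiagram (ToricPoset.toricPoset ω)).edgeSet ∧
      (ToricPoset.toricHasseDiagram (ToricPoset.toricPoset ω)).edgeSet ⊆
        (ToricPoset.toricTransClosure (ToricPoset.toricPoset ω)).edgeSet ∧
      (ToricPoset.toricTransClosure (ToricPoset.toricPoset ω)).edgeSet =
        ⋂ ω' ∈ ToricPoset.toricClass ω, (ToricPoset.transClosure ω'.poset).edgeSet := by
  refine ⟨SimpleGraph.edgeSet_mono (ToricPoset.hasseDiagram_le_toricHasseDiagram ω),
    SimpleGraph.edgeSet_mono (ToricPoset.toricHasseDiagram_le_toricTransClosure ω), ?_⟩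
  ext e
  induction e using Sym2.ind with
  | _ i j =>
    simp only [Set.mem_iInter, SimpleGraph.mem_edgeSet]
    exact ToricPoset.toricTransClosure_adj_iff ω i j
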